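/- For $n\ge 1$ let $\mathcal S_n(132)$ be the set of permutations $\sigma$ of $\{1,\dots,n\}$ for which there are no $i<j<k$ with $\sigma(i)<\sigma(k)<\sigma(j)$, let $\mathrm{fp}_n(\sigma)=\#\{i:\sigma(i)=i\}$, and for real $a,\varepsilon$ let $I_{n,\varepsilon}(a)$ be the set of integers $i\in\{1,\dots,n\}$ with $(a-\varepsilon)n\le i\le(a+\varepsilon)n$. Let $\varepsilon>0$, and for each $n\ge1$ let $\sigma\in\mathcal S_n(132)$ be chosen uniformly at random. Then \[\mathbf E[\mathrm{fp}_n(\sigma)]=1\quad\text{for all } n\ge 1.\] Moreover, for every $a\in(0,\tfrac12-\varepsilon)\cup(\tfrac12+\varepsilon,1-\varepsilon)$, \[\mathbf P\bigl(\sigma(i)=i\text{ for some } i\in I_{n,\varepsilon}(a)\bigr)\to 0\quad\text{as } n\to\infty.\] -/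

import Mathlib

open Filter Topology

/-- `σ` contains the pattern `τ`: some increasing sequence of positions carries values of `σ`
in the same relative order as the values of `τ`. -/
def ContainsPattern {n m : ℕ} (σ : Equiv.Perm (Fin n)) (τ : Equiv.Perm (Fin m)) : Prop :=
  ∃ f : Fin m → Fin n, StrictMono f ∧ ∀ i j : Fin m, σ (f i) < σ (f j) ↔ τ i < τ j

/-- The pattern `132`; with values and positions starting at `0` this is `0 ↦ 0, 1 ↦ 2, 2 ↦ 1`. -/
def pattern132 : Equiv.Perm (Fin 3) := Equiv.swap 1 2

open Classical in
/-- The set `S_n(τ)` of the permutations of `n` elements that avoid `τ`. -/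
noncomputable def avoidingPerms (n : ℕ) {m : ℕ} (τ : Equiv.Perm (Fin m)) :
    Finset (Equiv.Perm (Fin n)) :=
  Finset.univ.filter fun σ => ¬ ContainsPattern σ τ

/-- The number of fixed points of `σ`. -/
def numFixedPoints {n : ℕ} (σ : Equiv.Perm (Fin n)) : ℕ :=
  (Finset.univ.filter fun i : Fin n => σ i = i).card

/-- The expectation of `X` at a uniformly random element of the finite set `S`. -/
noncomputable def uniformExpectation {α : Type*} (S : Finset α) (X : α → ℝ) : ℝ :=
  (∑ x ∈ S, X x) / (S.card : ℝ)

open Classical in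
/-- The probability that a uniformly random element of the finite set `S` satisfies `p`. -/
noncomputable def uniformProb {α : Type*} (S : Finset α) (p : α → Prop) : ℝ :=
  ((S.filter p).card : ℝ) / (S.card : ℝ)

/-- `σ` has a fixed point in the window `I_{n,ε}(a) = [(a-ε)n, (a+ε)n] ∩ {1, …, n}`.
The element `i : Fin n` stands for the number `i + 1` of `{1, …, n}`. -/
def HasFixedPointInWindow (ε a : ℝ) {n : ℕ} (σ : Equiv.Perm (Fin n)) : Prop :=
  ∃ i : Fin n, ((i : ℕ) : ℝ) + 1 ∈ Set.Icc ((a - ε) * n) ((a + ε) * n) ∧ σ i = i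

/-! Cutting at the maximum codes 132-avoiders by binary trees. For a point with `p, a, b, e` points
to its SW, SE, NW, NE, write `C` for the Catalan series; the number of pairs (avoider, point) with
these counts is `catalan p * [x^a] C^(e+1) * [x^b] C^(e+1)` (`countPoints_eq`). With 0-based labels
the point has position `sw + nw` and value `sw + se`, so it is fixed iff `a = b`, and each fixed
point contributes to a sum of terms `catalan p * ([x^w] C^(h+1))^2` with `p + 2w + h = n - 1`
(`sum_card_fixedPoints`).

The coefficient `[x^w] C^(h+1)` counts nonnegative paths of length `2w + h` from `0` to `h`. Gluing
two such paths gives a Dyck path, so for fixed `p` the squares sum to `catalan (n - 1 - p)`; summing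
over `p` gives `catalan n`, the number of avoiders, so the mean is 1.

The window probability is at most the expected number of fixed points there. A fixed point below the
middle forces `h` to be linear in `n`, which is exponentially unlikely. One above it but away from
the end forces both `p` and `n - p` to be linear in `n`; the terms `catalan p * catalan (n - 1 - p)`
then total `O(4^n n^(-2))`, against `catalan n` of order `4^n n^(-3/2)`. -/

/-! ### Powers of the Catalan series and ballot paths -/

open PowerSeries in
/-- The coefficient of `x ^ w` in the `e`-th power of the Catalan series. -/
noncomputable def catalanPowCoeff (w e : ℕ) : ℕ := coeff w (catalanSeries ^ e)

lemma catalanPowCoeff_zero_left (e : ℕ) : catalanPowCoeff 0 e = 1 := by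
  simp [catalanPowCoeff]

lemma catalanPowCoeff_succ_zero (w : ℕ) : catalanPowCoeff (w + 1) 0 = 0 := by
  simp [catalanPowCoeff, PowerSeries.coeff_one]

lemma catalanPowCoeff_one (w : ℕ) : catalanPowCoeff w 1 = catalan w := by
  simp [catalanPowCoeff]

lemma catalanPowCoeff_succ_right (w e : ℕ) :
    catalanPowCoeff w (e + 1) =
      ∑ x ∈ Finset.HasAntidiagonal.antidiagonal w, catalan x.1 * catalanPowCoeff x.2 e := by
  simp [catalanPowCoeff, pow_succ', PowerSeries.coeff_mul]

/-- This is `C = 1 + x C^2` multiplied by `C^e`. -/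
lemma catalanPowCoeff_succ_succ (w e : ℕ) :
    catalanPowCoeff (w + 1) (e + 1) =
      catalanPowCoeff (w + 1) e + catalanPowCoeff w (e + 2) := by
  have h : PowerSeries.catalanSeries ^ (e + 1) =
      PowerSeries.catalanSeries ^ e + PowerSeries.catalanSeries ^ (e + 2) * PowerSeries.X := by
    calc PowerSeries.catalanSeries ^ (e + 1)
        = PowerSeries.catalanSeries ^ e *
            (PowerSeries.catalanSeries ^ 2 * PowerSeries.X + 1) := by
          rw [PowerSeries.catalanSeries_sq_mul_X_add_one, pow_succ]
      _ = _ := by ring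
  simp [catalanPowCoeff, h, PowerSeries.coeff_succ_mul_X]

/-- The number of nonnegative lattice paths with `m` steps `±1` from height `0` to height `h`. -/
def ballotPaths : ℕ → ℕ → ℕ
  | 0, 0 => 1
  | 0, _ + 1 => 0
  | m + 1, 0 => ballotPaths m 1
  | m + 1, h + 1 => ballotPaths m h + ballotPaths m (h + 2)

lemma ballotPaths_eq_zero_of_lt {m h : ℕ} (hmh : m < h) : ballotPaths m h = 0 := by
  induction m generalizing h with
  | zero => cases h with
    | zero => omega
    | succ h => rfl
  | succ m ih => cases h with
    | zero => omega
    | succ h => rw [ballotPaths, ih (by omega), ih (by omega)]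

lemma ballotPaths_eq_zero_of_odd {m h : ℕ} (hmh : (m + h) % 2 = 1) : ballotPaths m h = 0 := by
  induction m generalizing h with
  | zero => cases h with
    | zero => omega
    | succ h => rfl
  | succ m ih => cases h with
    | zero => rw [ballotPaths, ih (by omega)]
    | succ h => rw [ballotPaths, ih (by omega), ih (by omega)]

/-- Removing the last step of a path gives the same recursion as `C^(h+1) = C^h + x C^(h+2)`. -/
lemma ballotPaths_eq_catalanPowCoeff (w h : ℕ) :
    ballotPaths (2 * w + h) h = catalanPowCoeff w (h + 1) := by
  induction hm : 2 * w + h generalizing w h with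
  | zero =>
    obtain ⟨rfl, rfl⟩ : w = 0 ∧ h = 0 := by omega
    simp [ballotPaths, catalanPowCoeff_zero_left]
  | succ m ih =>
    rcases w with _ | w <;> rcases h with _ | h
    · omega
    · rw [ballotPaths, ih 0 h (by omega), ballotPaths_eq_zero_of_lt (by omega)]
      simp [catalanPowCoeff_zero_left]
    · rw [ballotPaths, ih w 1 (by omega), catalanPowCoeff_succ_succ, catalanPowCoeff_succ_zero,
        zero_add]
    · rw [ballotPaths, ih (w + 1) h (by omega), ih w (h + 2) (by omega),
        catalanPowCoeff_succ_succ w (h + 1)]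

/-- The right side is symmetric in `a` and `b`, so one step can be moved from one path to the other.
-/
lemma sum_ballotPaths_succ_mul {a b K : ℕ} (ha : a ≤ K) :
    ∑ h ∈ Finset.range (K + 1), ballotPaths (a + 1) h * ballotPaths b h =
      ∑ h ∈ Finset.range K, ballotPaths a h * ballotPaths b (h + 1) +
        ∑ h ∈ Finset.range K, ballotPaths a (h + 1) * ballotPaths b h := by
  have h1 : ∑ h ∈ Finset.range (K + 1), ballotPaths a (h + 1) * ballotPaths b h =
      ∑ h ∈ Finset.range K, ballotPaths a (h + 1) * ballotPaths b h := by
    rw [Finset.sum_range_succ, ballotPaths_eq_zero_of_lt (by omega : a < K + 1)]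
    simp
  rw [Finset.sum_range_succ', ← h1, Finset.sum_range_succ' _ K]
  simp only [ballotPaths, add_mul, Finset.sum_add_distrib]
  ring

/-- A path returning to `0` is cut at time `a`, and its second half is reversed. -/
lemma sum_ballotPaths_mul {a b K : ℕ} (h : a + b ≤ K) :
    ∑ h ∈ Finset.range (K + 1), ballotPaths a h * ballotPaths b h = ballotPaths (a + b) 0 := by
  induction b generalizing a with
  | zero =>
    rw [Finset.sum_range_succ']
    simp [ballotPaths]
  | succ b ih =>
    rw [show a + (b + 1) = a + 1 + b by ring, ← ih (a := a + 1) (by omega),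
      sum_ballotPaths_succ_mul (by omega : a ≤ K)]
    simp_rw [mul_comm (ballotPaths a _)]
    rw [sum_ballotPaths_succ_mul (by omega : b ≤ K), add_comm]

/-- The pairs `(w, h)` with `2 w + h = m`. -/
def ballotIndex (m : ℕ) : Finset (ℕ × ℕ) :=
  (Finset.range (m + 1) ×ˢ Finset.range (m + 1)).filter fun x => 2 * x.1 + x.2 = m

lemma mem_ballotIndex {m : ℕ} {x : ℕ × ℕ} : x ∈ ballotIndex m ↔ 2 * x.1 + x.2 = m := by
  simp only [ballotIndex, Finset.mem_filter, Finset.mem_product, Finset.mem_range]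
  omega

lemma sum_catalanPowCoeff_sq (m : ℕ) :
    ∑ x ∈ ballotIndex m, catalanPowCoeff x.1 (x.2 + 1) ^ 2 = catalan m := by
  have h := sum_ballotPaths_mul (le_refl (m + m))
  rw [show m + m = 2 * m + 0 by ring, ballotPaths_eq_catalanPowCoeff, catalanPowCoeff_one] at h
  rw [← h]
  refine Finset.sum_bij_ne_zero (fun x _ _ => x.2) ?_ ?_ ?_ ?_
  · intro x hx _
    rw [mem_ballotIndex] at hx
    rw [Finset.mem_range]
    omega
  · rintro ⟨w, h⟩ hx _ ⟨w', h'⟩ hx' _ he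
    rw [mem_ballotIndex] at hx hx'
    simp only at hx hx' he
    ext <;> simp only <;> omega
  · intro k _ hk
    have hk' : ballotPaths m k ≠ 0 := fun h0 => hk (by simp [h0])
    have h1 : k ≤ m := by
      by_contra! h1
      exact hk' (ballotPaths_eq_zero_of_lt h1)
    have h2 : (m + k) % 2 = 0 := by
      by_contra h2
      exact hk' (ballotPaths_eq_zero_of_odd (by omega))
    have hm : 2 * ((m - k) / 2) + k = m := by omega
    refine ⟨((m - k) / 2, k), mem_ballotIndex.2 hm, ?_, rfl⟩
    rw [← ballotPaths_eq_catalanPowCoeff, hm]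
    exact pow_ne_zero 2 hk'
  · intro x hx _
    rw [mem_ballotIndex] at hx
    rw [← ballotPaths_eq_catalanPowCoeff, hx, sq]

/-- `(y + y⁻¹)^m` is the generating function of all `±1` walks of length `m` by final height;
nonnegative walks ending at `h` are some of them. -/
lemma catalanPowCoeff_mul_pow_le (w h : ℕ) {y : ℝ} (hy : 0 < y) :
    (catalanPowCoeff w (h + 1) : ℝ) * y ^ h ≤ (y + y⁻¹) ^ (2 * w + h) := by
  rw [← ballotPaths_eq_catalanPowCoeff]
  generalize 2 * w + h = m
  induction m generalizing h with
  | zero => cases h <;> simp [ballotPaths]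
  | succ m ih =>
    have hs : y⁻¹ * (y + y⁻¹) ^ m + y * (y + y⁻¹) ^ m = (y + y⁻¹) ^ (m + 1) := by ring
    rw [← hs]
    have hpos : 0 ≤ y * (y + y⁻¹) ^ m := by positivity
    cases h with
    | zero =>
      have h1 := mul_le_mul_of_nonneg_left (ih 1) (inv_pos.2 hy).le
      have h2 : y⁻¹ * ((ballotPaths m 1 : ℝ) * y ^ 1) = ballotPaths m 1 := by field_simp
      rw [h2] at h1
      simp only [ballotPaths, pow_zero, mul_one]
      linarith
    | succ h =>
      have h1 := mul_le_mul_of_nonneg_left (ih (h + 2)) (inv_pos.2 hy).le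
      have h2 := mul_le_mul_of_nonneg_left (ih h) hy.le
      have h3 : y⁻¹ * ((ballotPaths m (h + 2) : ℝ) * y ^ (h + 2)) =
        ballotPaths m (h + 2) * y ^ (h + 1) := by
        rw [pow_succ y (h + 1)]
        field_simp
      rw [h3] at h1
      simp only [ballotPaths, Nat.cast_add]
      calc _ = (ballotPaths m (h + 2) : ℝ) * y ^ (h + 1) + y * (ballotPaths m h * y ^ h) := by ring
        _ ≤ _ := add_le_add h1 h2

/-! ### Quadrant counts of a point -/

/-- The position of a point of a permutation relative to the others: the numbers of points
to the south-west, south-east, north-west and north-east of it. -/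
@[ext]
structure QuadrantCounts where
  /-- number of points to the south-west -/
  sw : ℕ
  /-- number of points to the south-east -/
  se : ℕ
  /-- number of points to the north-west -/
  nw : ℕ
  /-- number of points to the north-east -/
  ne : ℕ
  deriving DecidableEq

namespace QuadrantCounts

/-- The effect on a point of adding `r` points to the south-east and one to the north-east. -/
def addRight (r : ℕ) (q : QuadrantCounts) : QuadrantCounts := ⟨q.sw, q.se + r, q.nw, q.ne + 1⟩

/-- The effect on a point of adding `l + 1` points to the north-west. -/
def addLeft (l : ℕ) (q : QuadrantCounts) : QuadrantCounts := ⟨q.sw, q.se, q.nw + (l + 1), q.ne⟩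

lemma addRight_injective (r : ℕ) : Function.Injective (addRight r) := by
  intro x y h
  simp only [addRight, mk.injEq] at h
  ext <;> omega

lemma addLeft_injective (l : ℕ) : Function.Injective (addLeft l) := by
  intro x y h
  simp only [addLeft, mk.injEq] at h
  ext <;> omega

/-- The number of points, including the point itself. -/
def total (q : QuadrantCounts) : ℕ := q.sw + q.se + q.nw + q.ne + 1

lemma count_map_addRight (r : ℕ) (s : Multiset QuadrantCounts) (q : QuadrantCounts) :
    (s.map (addRight r)).count q =
      if r ≤ q.se ∧ 1 ≤ q.ne then s.count ⟨q.sw, q.se - r, q.nw, q.ne - 1⟩ else 0 := by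
  split_ifs with h
  · rw [← Multiset.count_map_eq_count' _ s (addRight_injective r)]
    refine congrArg₂ Multiset.count ?_ rfl
    ext <;> simp only [addRight] <;> omega
  · rw [Multiset.count_eq_zero, Multiset.mem_map]
    rintro ⟨x, -, rfl⟩
    exact h (by simp [addRight])

lemma count_map_addLeft (l : ℕ) (s : Multiset QuadrantCounts) (q : QuadrantCounts) :
    (s.map (addLeft l)).count q =
      if l + 1 ≤ q.nw then s.count ⟨q.sw, q.se, q.nw - (l + 1), q.ne⟩ else 0 := by
  split_ifs with h
  · rw [← Multiset.count_map_eq_count' _ s (addLeft_injective l)]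
    refine congrArg₂ Multiset.count ?_ rfl
    ext <;> simp only [addLeft]
    omega
  · rw [Multiset.count_eq_zero, Multiset.mem_map]
    rintro ⟨x, -, rfl⟩
    exact h (by simp [addLeft])

end QuadrantCounts

/-! ### Counting points of trees by their quadrant counts -/

namespace BinaryTree

open QuadrantCounts

/-- The quadrant counts of the points of the `132`-avoiding permutation coded by a tree. -/
def quadrantCounts : BinaryTree Unit → Multiset QuadrantCounts
  | nil => 0
  | node _ l r => ⟨l.numNodes, r.numNodes, 0, 0⟩ ::ₘ
      (l.quadrantCounts.map (addRight r.numNodes) + r.quadrantCounts.map (addLeft l.numNodes))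

lemma total_of_mem_quadrantCounts {t : BinaryTree Unit} {q : QuadrantCounts}
    (hq : q ∈ t.quadrantCounts) : q.total = t.numNodes := by
  induction t using unitRecOn generalizing q with
  | base => simp [quadrantCounts] at hq
  | ind l r ihl ihr =>
    simp only [quadrantCounts, Multiset.mem_cons, Multiset.mem_add, Multiset.mem_map] at hq
    obtain rfl | ⟨x, hx, rfl⟩ | ⟨x, hx, rfl⟩ := hq
    · simp [total, numNodes]
    · have := ihl hx
      simp only [total, addRight, numNodes] at *
      omega
    · have := ihr hx
      simp only [total, addLeft, numNodes] at *
      omega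

lemma sum_treesOfNumNodesEq_succ {M : Type*} [AddCommMonoid M] (f : BinaryTree Unit → M) (n : ℕ) :
    ∑ t ∈ treesOfNumNodesEq (n + 1), f t =
      ∑ x ∈ Finset.HasAntidiagonal.antidiagonal n, ∑ l ∈ treesOfNumNodesEq x.1,
        ∑ r ∈ treesOfNumNodesEq x.2, f (node () l r) := by
  rw [treesOfNumNodesEq_succ, Finset.sum_biUnion]
  · refine Finset.sum_congr rfl fun x _ => ?_
    rw [Finset.sum_map, Finset.sum_product]
    rfl
  · simp_rw [Set.PairwiseDisjoint, Set.Pairwise, Finset.disjoint_left]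
    aesop

/-- The number of pairs of a tree with `n` nodes and a point with quadrant counts `q`. -/
def countPoints (n : ℕ) (q : QuadrantCounts) : ℕ :=
  ∑ t ∈ treesOfNumNodesEq n, t.quadrantCounts.count q

/-- The three sums collect the points at the root, in the left subtree and in the right subtree. -/
lemma countPoints_succ (n : ℕ) (q : QuadrantCounts) :
    countPoints (n + 1) q =
      (∑ x ∈ Finset.HasAntidiagonal.antidiagonal n,
        if q = ⟨x.1, x.2, 0, 0⟩ then catalan x.1 * catalan x.2 else 0) +
      (∑ x ∈ Finset.HasAntidiagonal.antidiagonal n, if x.2 ≤ q.se ∧ 1 ≤ q.ne then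
        catalan x.2 * countPoints x.1 ⟨q.sw, q.se - x.2, q.nw, q.ne - 1⟩ else 0) +
      ∑ x ∈ Finset.HasAntidiagonal.antidiagonal n, if x.1 + 1 ≤ q.nw then
        catalan x.1 * countPoints x.2 ⟨q.sw, q.se, q.nw - (x.1 + 1), q.ne⟩ else 0 := by
  rw [countPoints, sum_treesOfNumNodesEq_succ, ← Finset.sum_add_distrib, ← Finset.sum_add_distrib]
  refine Finset.sum_congr rfl fun x _ => ?_
  have h : ∀ l ∈ treesOfNumNodesEq x.1, ∀ r ∈ treesOfNumNodesEq x.2,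
      (node () l r).quadrantCounts.count q =
        (if q = ⟨x.1, x.2, 0, 0⟩ then 1 else 0) +
        (if x.2 ≤ q.se ∧ 1 ≤ q.ne then
          l.quadrantCounts.count ⟨q.sw, q.se - x.2, q.nw, q.ne - 1⟩ else 0) +
        (if x.1 + 1 ≤ q.nw then
          r.quadrantCounts.count ⟨q.sw, q.se, q.nw - (x.1 + 1), q.ne⟩ else 0) := by
    intro l hl r hr
    rw [mem_treesOfNumNodesEq] at hl hr
    rw [quadrantCounts, Multiset.count_cons, Multiset.count_add, count_map_addRight,
      count_map_addLeft, hl, hr]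
    ring
  rw [Finset.sum_congr rfl fun l hl => Finset.sum_congr rfl fun r hr => h l hl r hr]
  simp only [Finset.sum_add_distrib]
  congr 1
  · congr 1
    · simp [treesOfNumNodesEq_card_eq_catalan]
    · split_ifs
      · simp only [Finset.sum_const, treesOfNumNodesEq_card_eq_catalan, smul_eq_mul, countPoints,
          Finset.mul_sum]
      · simp
  · split_ifs
    · simp only [Finset.sum_const, treesOfNumNodesEq_card_eq_catalan, smul_eq_mul, countPoints]
    · simp

lemma sum_antidiagonal_snd_le {M : Type*} [AddCommMonoid M] {a n : ℕ} (h : a ≤ n)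
    (f : ℕ → ℕ → M) :
    (∑ x ∈ Finset.HasAntidiagonal.antidiagonal n, if x.2 ≤ a then f x.2 (a - x.2) else 0) =
      ∑ x ∈ Finset.HasAntidiagonal.antidiagonal a, f x.1 x.2 := by
  rw [← Finset.sum_filter]
  refine Finset.sum_bij' (fun x _ => (x.2, a - x.2)) (fun x _ => (n - x.1, x.1)) ?_ ?_ ?_ ?_ ?_ <;>
    simp only [Finset.mem_filter, Finset.HasAntidiagonal.mem_antidiagonal, Prod.forall,
      Prod.mk.injEq, and_true, true_and] <;> intros <;> first | omega | trivial

/-- Follow the path from the root to the node. Its left subtree has `p` nodes. The `e` left turns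
each leave a right subtree to the SE; with the node's own right subtree these give `C^(e+1)`. Right
turns fill the `e + 1` gaps between left turns, each putting a node and its left subtree to the NW;
a gap contributes `1/(1 - xC) = C`. The induction checks this against `countPoints_succ`. -/
theorem countPoints_eq (p a b e : ℕ) :
    countPoints (p + a + b + e + 1) ⟨p, a, b, e⟩ =
      catalan p * (catalanPowCoeff a (e + 1) * catalanPowCoeff b (e + 1)) := by
  induction hn : p + a + b + e using Nat.strong_induction_on generalizing a b e with
  | _ n ih =>
  rw [countPoints_succ]
  have h1 : (∑ x ∈ Finset.HasAntidiagonal.antidiagonal n,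
      if (⟨p, a, b, e⟩ : QuadrantCounts) = ⟨x.1, x.2, 0, 0⟩ then
        catalan x.1 * catalan x.2 else 0) =
      if b = 0 ∧ e = 0 then catalan p * catalan a else 0 := by
    split_ifs with h
    · obtain ⟨rfl, rfl⟩ := h
      rw [Finset.sum_eq_single (p, a)]
      · simp
      · rintro ⟨x, y⟩ - hxy
        rw [if_neg]
        rintro h
        simp only [QuadrantCounts.mk.injEq] at h
        exact hxy (by rw [h.1, h.2.1])
      · intro h
        exact absurd (Finset.HasAntidiagonal.mem_antidiagonal.2 (by simpa using hn)) h
    · refine Finset.sum_eq_zero fun x _ => if_neg fun hx => h ?_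
      simp only [QuadrantCounts.mk.injEq] at hx
      exact hx.2.2
  have h2 : (∑ x ∈ Finset.HasAntidiagonal.antidiagonal n, if x.2 ≤ a ∧ 1 ≤ e then
        catalan x.2 * countPoints x.1 ⟨p, a - x.2, b, e - 1⟩ else 0) =
      if 1 ≤ e then catalan p * (catalanPowCoeff a (e + 1) * catalanPowCoeff b e) else 0 := by
    split_ifs with he
    · obtain ⟨e, rfl⟩ := Nat.exists_eq_add_of_le' he
      rw [catalanPowCoeff_succ_right a (e + 1), Finset.sum_mul, Finset.mul_sum,
        ← sum_antidiagonal_snd_le (by omega : a ≤ n)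
          (fun i j => catalan p * (catalan i * catalanPowCoeff j (e + 1) *
            catalanPowCoeff b (e + 1)))]
      refine Finset.sum_congr rfl fun x hx => ?_
      rw [Finset.HasAntidiagonal.mem_antidiagonal] at hx
      by_cases hxa : x.2 ≤ a
      · rw [if_pos ⟨hxa, he⟩, if_pos hxa]
        have hx1 : x.1 = p + (a - x.2) + b + e + 1 := by omega
        rw [Nat.add_sub_cancel, hx1, ih _ (by omega) (a - x.2) b e rfl]
        ring
      · rw [if_neg fun h => hxa h.1, if_neg hxa]
    · exact Finset.sum_eq_zero fun x _ => if_neg fun h => he h.2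
  have h3 : (∑ x ∈ Finset.HasAntidiagonal.antidiagonal n, if x.1 + 1 ≤ b then
        catalan x.1 * countPoints x.2 ⟨p, a, b - (x.1 + 1), e⟩ else 0) =
      if 1 ≤ b then catalan p * (catalanPowCoeff a (e + 1) * catalanPowCoeff (b - 1) (e + 2))
        else 0 := by
    split_ifs with hb
    · obtain ⟨b, rfl⟩ := Nat.exists_eq_add_of_le' hb
      rw [Nat.add_sub_cancel, catalanPowCoeff_succ_right b (e + 1), Finset.mul_sum, Finset.mul_sum,
        ← sum_antidiagonal_snd_le (by omega : b ≤ n)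
          (fun i j => catalan p * (catalanPowCoeff a (e + 1) *
            (catalan i * catalanPowCoeff j (e + 1)))), ← Finset.Nat.sum_antidiagonal_swap]
      refine Finset.sum_congr rfl fun x hx => ?_
      rw [Finset.HasAntidiagonal.mem_antidiagonal] at hx
      by_cases hxb : x.2 ≤ b
      · rw [if_pos (by simpa using hxb), if_pos hxb]
        have hx1 : x.1 = p + a + (b - x.2) + e + 1 := by omega
        simp only [Nat.add_sub_add_right, Prod.fst_swap, Prod.snd_swap]
        rw [hx1, ih _ (by omega) a (b - x.2) e rfl]
        ring
      · rw [if_neg (by simpa using hxb), if_neg hxb]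
    · exact Finset.sum_eq_zero fun x _ => if_neg fun h => hb (by omega)
  simp only at h1 h2 h3 ⊢
  rw [h1, h2, h3]
  -- What remains is the recursion `catalanPowCoeff_succ_succ` in `b`; the root term accounts for
  -- the constant term of `C^0`.
  rcases b with _ | b <;> rcases e with _ | e
  · simp [catalanPowCoeff_one]
  · simp [catalanPowCoeff_zero_left]
  · simp [catalanPowCoeff_succ_succ, catalanPowCoeff_succ_zero]
  · simp [catalanPowCoeff_succ_succ b]
    ring

end BinaryTree

/-! ### Coding 132-avoiding permutations by trees -/

namespace BinaryTree

open QuadrantCounts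

/-- The `132`-avoiding permutation of `{0, …, n - 1}` coded by a tree with `n` nodes: the entries
before the maximum come from the left subtree and exceed those after it, which come from the right
subtree. -/
def permFun : BinaryTree Unit → ℕ → ℕ
  | nil, i => i
  | node _ l r, i =>
    if i < l.numNodes then l.permFun i + r.numNodes
    else if i = l.numNodes then l.numNodes + r.numNodes
    else r.permFun (i - (l.numNodes + 1))

lemma permFun_lt {t : BinaryTree Unit} {i : ℕ} (hi : i < t.numNodes) :
    t.permFun i < t.numNodes := by
  induction t using unitRecOn generalizing i with
  | base => simp at hi
  | ind l r ihl ihr =>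
    simp only [numNodes, permFun] at *
    split_ifs with h1 h2
    · have := ihl h1
      omega
    · omega
    · have := ihr (i := i - (l.numNodes + 1)) (by omega)
      omega

lemma permFun_node_of_lt {l r : BinaryTree Unit} {i : ℕ} (hi : i < l.numNodes) :
    (node () l r).permFun i = l.permFun i + r.numNodes := by
  rw [permFun, if_pos hi]

lemma permFun_node_self (l r : BinaryTree Unit) :
    (node () l r).permFun l.numNodes = l.numNodes + r.numNodes := by
  rw [permFun, if_neg (lt_irrefl _), if_pos rfl]

lemma permFun_node_add (l r : BinaryTree Unit) (i : ℕ) :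
    (node () l r).permFun (l.numNodes + 1 + i) = r.permFun i := by
  rw [permFun, if_neg (by omega), if_neg (by omega), Nat.add_sub_cancel_left]

lemma lt_or_eq_or_exists_add (a i : ℕ) : i < a ∨ i = a ∨ ∃ j, i = a + 1 + j := by
  rcases lt_trichotomy i a with h | h | h
  · exact Or.inl h
  · exact Or.inr (Or.inl h)
  · exact Or.inr (Or.inr ⟨i - (a + 1), by omega⟩)

lemma permFun_injOn {t : BinaryTree Unit} {i j : ℕ} (hi : i < t.numNodes) (hj : j < t.numNodes)
    (h : t.permFun i = t.permFun j) : i = j := by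
  induction t using unitRecOn generalizing i j with
  | base => simp at hi
  | ind l r ihl ihr =>
    simp only [numNodes] at hi hj
    rcases lt_or_eq_or_exists_add l.numNodes i with hi' | rfl | ⟨i, rfl⟩ <;>
    rcases lt_or_eq_or_exists_add l.numNodes j with hj' | rfl | ⟨j, rfl⟩ <;>
    simp only [permFun_node_of_lt, permFun_node_self, permFun_node_add, *] at h
    · exact ihl hi' hj' (by omega)
    · have := permFun_lt hi'
      omega
    · have := permFun_lt (show j < r.numNodes by omega)
      omega
    · have := permFun_lt hj'
      omega
    · rfl
    · have := permFun_lt (show j < r.numNodes by omega)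
      omega
    · have := permFun_lt (show i < r.numNodes by omega)
      omega
    · have := permFun_lt (show i < r.numNodes by omega)
      omega
    · rw [ihr (by omega) (by omega) h]

lemma permFun_avoids {t : BinaryTree Unit} {i j k : ℕ} (hij : i < j) (hjk : j < k)
    (hk : k < t.numNodes) (h1 : t.permFun i < t.permFun k) : t.permFun j ≤ t.permFun k := by
  induction t using unitRecOn generalizing i j k with
  | base => simp at hk
  | ind l r ihl ihr =>
    simp only [numNodes] at hk
    rcases lt_or_eq_or_exists_add l.numNodes k with hk' | rfl | ⟨k, rfl⟩
    · have hj' := hjk.trans hk'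
      have hi' := hij.trans hj'
      rw [permFun_node_of_lt hi', permFun_node_of_lt hk'] at h1
      rw [permFun_node_of_lt hj', permFun_node_of_lt hk']
      have := ihl hij hjk hk' (by omega)
      omega
    · rw [permFun_node_of_lt hjk, permFun_node_self]
      have := permFun_lt hjk
      omega
    · have hkr := permFun_lt (show k < r.numNodes by omega)
      rw [permFun_node_add] at h1 ⊢
      rcases lt_or_eq_or_exists_add l.numNodes i with hi' | rfl | ⟨i, rfl⟩
      · rw [permFun_node_of_lt hi'] at h1
        omega
      · rw [permFun_node_self] at h1
        omega
      · obtain ⟨j, rfl⟩ : ∃ j', j = l.numNodes + 1 + j' := ⟨j - (l.numNodes + 1), by omega⟩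
        rw [permFun_node_add] at h1 ⊢
        exact ihr (by omega) (by omega) (by omega) h1

/-- The position of the maximum determines the size of the left subtree, so the tree can be read off
recursively. -/
lemma eq_of_permFun_eq {s t : BinaryTree Unit} (hst : s.numNodes = t.numNodes)
    (h : ∀ i < t.numNodes, s.permFun i = t.permFun i) : s = t := by
  induction t using unitRecOn generalizing s with
  | base =>
    cases s with
    | nil => rfl
    | node u a b => simp at hst
  | ind l r ihl ihr =>
    cases s with
    | nil => simp at hst
    | node u a b =>
      simp only [numNodes] at hst h
      have ha : a.numNodes = l.numNodes := by
        refine permFun_injOn (t := node () l r) (by simp only [numNodes]; omega)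
          (by simp only [numNodes]; omega) ?_
        rw [← h _ (by omega), permFun_node_self, permFun_node_self]
        omega
      have hb : b.numNodes = r.numNodes := by omega
      have hal : a = l := by
        refine ihl ha fun i hi => ?_
        have := h i (by omega)
        rw [permFun_node_of_lt (by omega), permFun_node_of_lt hi] at this
        omega
      have hbr : b = r := by
        refine ihr hb fun i hi => ?_
        have := h (l.numNodes + 1 + i) (by omega)
        rw [permFun_node_add, ← ha, permFun_node_add] at this
        exact this
      rw [hal, hbr]

lemma exists_permFun_eq (n : ℕ) (g : ℕ → ℕ) (hg : ∀ i < n, g i < n)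
    (hinj : ∀ i < n, ∀ j < n, g i = g j → i = j)
    (hav : ∀ i j k, i < j → j < k → k < n → g i < g k → g j ≤ g k) :
    ∃ t : BinaryTree Unit, t.numNodes = n ∧ ∀ i < n, t.permFun i = g i := by
  induction n using Nat.strong_induction_on generalizing g with
  | _ n ih =>
  rcases n with _ | n
  · exact ⟨nil, rfl, by simp⟩
  obtain ⟨l, hl, hgl⟩ : ∃ l < n + 1, g l = n := by
    have hbij : Set.SurjOn g (Finset.range (n + 1)) (Finset.range (n + 1)) :=
      Finset.surjOn_of_injOn_of_card_le g (fun i hi => by simpa using hg i (by simpa using hi))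
        (fun i hi j hj => hinj i (by simpa using hi) j (by simpa using hj)) le_rfl
    obtain ⟨l, hl, h⟩ := hbij (show n ∈ (Finset.range (n + 1) : Set ℕ) by simp)
    exact ⟨l, by simpa using hl, h⟩
  have hne : ∀ i < n + 1, i ≠ l → g i < n := fun i hi hil => by
    have h1 := hg i hi
    have h2 : g i ≠ n := fun h => hil (hinj i hi l hl (h.trans hgl.symm))
    omega
  -- Otherwise `i`, the maximum at `l`, and `j` form a 132. Counting then forces the values left of
  -- `l` to be at least `n - l` and those right of it to be below `n - l`.
  have hdesc : ∀ i < l, ∀ j, l < j → j < n + 1 → g j < g i := fun i hi j hj hjn => by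
    by_contra! h
    rcases h.lt_or_eq with h | h
    · have h1 := hav i l j hi hj hjn h
      have h2 := hne j hjn (by omega)
      omega
    · have := hinj i (by omega) j hjn h
      omega
  have hleft : ∀ i < l, n - l ≤ g i := fun i hi => by
    have := Finset.card_le_card_of_injOn (s := Finset.Ioc l n) (t := Finset.range (g i)) g
      (fun j hj => by
        simp only [Finset.coe_Ioc, Set.mem_Ioc] at hj
        simpa using hdesc i hi j hj.1 (by omega))
      (fun j hj k hk => by
        simp only [Finset.coe_Ioc, Set.mem_Ioc] at hj hk
        exact hinj j (by omega) k (by omega))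
    simpa using this
  have hright : ∀ j, l < j → j < n + 1 → g j < n - l := fun j hj hjn => by
    have hjn' := hne j hjn (by omega)
    have := Finset.card_le_card_of_injOn (s := Finset.range l) (t := Finset.Ioo (g j) n) g
      (fun i hi => by
        simp only [Finset.coe_range, Set.mem_Iio] at hi
        simpa using ⟨hdesc i hi j hj hjn, hne i (by omega) (by omega)⟩)
      (fun i hi k hk => by
        simp only [Finset.coe_range, Set.mem_Iio] at hi hk
        exact hinj i (by omega) k (by omega))
    rw [Finset.card_range, Nat.card_Ioo] at this
    omega
  obtain ⟨s, hs, hsg⟩ := ih l (by omega) (fun i => g i - (n - l))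
    (fun i hi => by
      have := hne i (by omega) (by omega)
      omega)
    (fun i hi j hj h => hinj i (by omega) j (by omega) (by
      have := hleft i hi
      have := hleft j hj
      omega))
    (fun i j k hij hjk hk h => by
      have := hav i j k hij hjk (by omega) (by omega)
      omega)
  obtain ⟨t, ht, htg⟩ := ih (n - l) (by omega) (fun i => g (l + 1 + i))
    (fun i hi => hright _ (by omega) (by omega))
    (fun i hi j hj h => by
      have := hinj _ (by omega) _ (by omega) h
      omega)
    (fun i j k hij hjk hk h => hav _ _ _ (by omega) (by omega) (by omega) h)
  refine ⟨node () s t, by simp only [numNodes]; omega, fun i hi => ?_⟩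
  rcases lt_or_eq_or_exists_add s.numNodes i with h | rfl | ⟨i, rfl⟩
  · have := hleft i (by omega)
    rw [permFun_node_of_lt h, hsg i (by omega)]
    omega
  · rw [permFun_node_self, hs, ht, hgl]
    omega
  · rw [permFun_node_add, htg i (by omega), hs]

/-- With 0-based labels, the position of a point counts the points to its left and its value counts
those below it. -/
lemma map_range_permFun (t : BinaryTree Unit) :
    (Multiset.range t.numNodes).map (fun i => (i, t.permFun i)) =
      t.quadrantCounts.map (fun q => (q.sw + q.nw, q.sw + q.se)) := by
  induction t using unitRecOn with
  | base => simp [quadrantCounts]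
  | ind l r ihl ihr =>
    have h : (node () l r).numNodes = l.numNodes + 1 + r.numNodes := by
      simp only [numNodes]
      omega
    rw [h, Multiset.range_add, Multiset.range_succ, quadrantCounts, Multiset.map_add,
      Multiset.map_cons, Multiset.map_cons, Multiset.map_add, permFun_node_self, Multiset.map_map,
      Multiset.map_map, Multiset.map_map, Multiset.cons_add]
    congr 1
    congr 1
    · have hl := congrArg (Multiset.map fun x : ℕ × ℕ => (x.1, x.2 + r.numNodes)) ihl
      rw [Multiset.map_map, Multiset.map_map] at hl
      convert hl using 1
      · refine Multiset.map_congr rfl fun i hi => ?_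
        simp [permFun_node_of_lt (Multiset.mem_range.1 hi)]
      · refine Multiset.map_congr rfl fun q _ => ?_
        simp [addRight, add_assoc]
    · have hr := congrArg (Multiset.map fun x : ℕ × ℕ => (l.numNodes + 1 + x.1, x.2)) ihr
      rw [Multiset.map_map, Multiset.map_map] at hr
      convert hr using 1
      · refine Multiset.map_congr rfl fun i _ => ?_
        simp [permFun_node_add]
      · refine Multiset.map_congr rfl fun q _ => ?_
        simp only [Function.comp_apply, addLeft, Prod.mk.injEq, and_true]
        omega

lemma card_filter_permFun (t : BinaryTree Unit) (P : ℕ → Prop) [DecidablePred P] :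
    ((Finset.range t.numNodes).filter fun i => t.permFun i = i ∧ P i).card =
      (t.quadrantCounts.filter fun q => q.se = q.nw ∧ P (q.sw + q.nw)).card := by
  have h := congrArg (Multiset.countP fun x : ℕ × ℕ => x.2 = x.1 ∧ P x.1) (map_range_permFun t)
  rw [Multiset.countP_map, Multiset.countP_map] at h
  simpa [Finset.card_def] using h

end BinaryTree

/-! ### From permutations to trees, and the fixed point count -/

lemma containsPattern_pattern132_iff {n : ℕ} (σ : Equiv.Perm (Fin n)) :
    ContainsPattern σ pattern132 ↔ ∃ i j k, i < j ∧ j < k ∧ σ i < σ k ∧ σ k < σ j := by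
  constructor
  · rintro ⟨f, hf, h⟩
    exact ⟨f 0, f 1, f 2, hf (by decide), hf (by decide), (h 0 2).2 (by decide),
      (h 2 1).2 (by decide)⟩
  · rintro ⟨i, j, k, hij, hjk, h1, h2⟩
    have h3 := h1.trans h2
    refine ⟨![i, j, k], ?_, ?_⟩
    · intro a b hab
      fin_cases a <;> fin_cases b <;>
        first | exact absurd hab (by decide) | simp [hij, hjk, hij.trans hjk]
    · have e0 : pattern132 0 = 0 := by decide
      have e1 : pattern132 1 = 2 := by decide
      have e2 : pattern132 2 = 1 := by decide
      intro a b
      fin_cases a <;> fin_cases b <;> simp [e0, e1, e2, h1, h2, h3, h1.le, h2.le, h3.le]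

lemma mem_avoidingPerms_pattern132 {n : ℕ} {σ : Equiv.Perm (Fin n)} :
    σ ∈ avoidingPerms n pattern132 ↔ ∀ i j k, i < j → j < k → σ i < σ k → σ j ≤ σ k := by
  simp only [avoidingPerms, Finset.mem_filter, Finset.mem_univ, true_and,
    containsPattern_pattern132_iff]
  push Not
  rfl

open BinaryTree in
lemma sum_avoidingPerms_eq_sum_trees {M : Type*} [AddCommMonoid M] {n : ℕ}
    {F : Equiv.Perm (Fin n) → M} {G : BinaryTree Unit → M}
    (h : ∀ σ t, t.numNodes = n → (∀ i : Fin n, t.permFun i = σ i) → F σ = G t) :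
    ∑ σ ∈ avoidingPerms n pattern132, F σ = ∑ t ∈ treesOfNumNodesEq n, G t := by
  have hex : ∀ σ ∈ avoidingPerms n pattern132, ∃ t : BinaryTree Unit, t.numNodes = n ∧
      ∀ i : Fin n, t.permFun i = σ i := by
    intro σ hσ
    rw [mem_avoidingPerms_pattern132] at hσ
    obtain ⟨t, ht, htg⟩ := exists_permFun_eq n (fun i => if hi : i < n then σ ⟨i, hi⟩ else i)
      (fun i hi => by simp [hi])
      (fun i hi j hj hij => by
        simp only [hi, hj, dif_pos] at hij
        simpa using σ.injective (Fin.ext hij))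
      (fun i j k hij hjk hk hik => by
        have hj := hjk.trans hk
        have hi := hij.trans hj
        simp only [hi, hj, hk, dif_pos] at hik ⊢
        exact hσ ⟨i, hi⟩ ⟨j, hj⟩ ⟨k, hk⟩ hij hjk hik)
    exact ⟨t, ht, fun i => by rw [htg i i.2, dif_pos i.2]⟩
  choose! T hT hTσ using hex
  refine Finset.sum_bij (fun σ _ => T σ) ?_ ?_ ?_ ?_
  · exact fun σ hσ => mem_treesOfNumNodesEq.2 (hT σ hσ)
  · intro σ hσ τ hτ he
    ext i
    rw [← hTσ σ hσ, ← hTσ τ hτ, he]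
  · intro t ht
    rw [mem_treesOfNumNodesEq] at ht
    subst ht
    let f : Fin t.numNodes → Fin t.numNodes := fun i => ⟨t.permFun i, permFun_lt i.2⟩
    have hf : Function.Injective f := fun i j hij =>
      Fin.ext (permFun_injOn i.2 j.2 (congrArg Fin.val hij))
    let σ := Equiv.ofBijective f (Finite.injective_iff_bijective.1 hf)
    have hσ : σ ∈ avoidingPerms t.numNodes pattern132 :=
      mem_avoidingPerms_pattern132.2 fun i j k hij hjk hik =>
        permFun_avoids (t := t) hij hjk k.2 hik
    exact ⟨σ, hσ, eq_of_permFun_eq (hT σ hσ) fun i hi => hTσ σ hσ ⟨i, hi⟩⟩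
  · exact fun σ hσ => h σ (T σ) (hT σ hσ) (hTσ σ hσ)

theorem card_avoidingPerms_pattern132 (n : ℕ) :
    (avoidingPerms n pattern132).card = catalan n := by
  rw [← BinaryTree.treesOfNumNodesEq_card_eq_catalan, Finset.card_eq_sum_ones,
    Finset.card_eq_sum_ones, sum_avoidingPerms_eq_sum_trees fun _ _ _ _ => rfl]

open BinaryTree in
/-- The total number of fixed points `i` with `P i` of the `132`-avoiding permutations. -/
theorem sum_card_fixedPoints (m : ℕ) (P : ℕ → Prop) [DecidablePred P] :
    ∑ σ ∈ avoidingPerms (m + 1) pattern132,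
        (Finset.univ.filter fun i : Fin (m + 1) => σ i = i ∧ P i).card =
      ∑ p ∈ Finset.range (m + 1), ∑ x ∈ ballotIndex (m - p),
        if P (p + x.1) then catalan p * catalanPowCoeff x.1 (x.2 + 1) ^ 2 else 0 := by
  rw [sum_avoidingPerms_eq_sum_trees
    (G := fun t => (t.quadrantCounts.filter fun q => q.se = q.nw ∧ P (q.sw + q.nw)).card)]
  -- A fixed point has counts `(p, w, w, h)` with `p + 2w + h = m`; this finite index set allows the
  -- sums over trees and over counts to be exchanged.
  · have hsub : ∀ t ∈ treesOfNumNodesEq (m + 1),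
        ∀ q ∈ t.quadrantCounts.filter fun q => q.se = q.nw ∧ P (q.sw + q.nw),
        q ∈ ((Finset.range (m + 1)).sigma fun p => ballotIndex (m - p)).image
          fun x => (⟨x.1, x.2.1, x.2.1, x.2.2⟩ : QuadrantCounts) := by
      intro t ht q hq
      rw [mem_treesOfNumNodesEq] at ht
      rw [Multiset.mem_filter] at hq
      have h := total_of_mem_quadrantCounts hq.1
      rw [QuadrantCounts.total, ht] at h
      rw [Finset.mem_image]
      refine ⟨⟨q.sw, q.se, q.ne⟩, ?_, ?_⟩
      · rw [Finset.mem_sigma, Finset.mem_range, mem_ballotIndex]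
        simp only
        omega
      · ext
        · rfl
        · rfl
        · exact hq.2.1
        · rfl
    rw [Finset.sum_congr rfl fun t ht => (Multiset.sum_count_eq_card (hsub t ht)).symm,
      Finset.sum_comm, Finset.sum_image, Finset.sum_sigma]
    · refine Finset.sum_congr rfl fun p hp => Finset.sum_congr rfl fun x hx => ?_
      rw [Finset.mem_range] at hp
      rw [mem_ballotIndex] at hx
      simp only [Multiset.count_filter, true_and]
      split_ifs
      · have h := countPoints_eq p x.1 x.1 x.2
        rw [show p + x.1 + x.1 + x.2 + 1 = m + 1 by omega, countPoints] at h
        rw [h, sq]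
      · simp
    · rintro ⟨p, w, h⟩ - ⟨p', w', h'⟩ - he
      simp only [QuadrantCounts.mk.injEq] at he
      obtain ⟨rfl, rfl, -, rfl⟩ := he
      rfl
  · intro σ t ht hσ
    rw [← card_filter_permFun, ht, Finset.card_filter, Finset.card_filter, Finset.sum_range]
    refine Finset.sum_congr rfl fun i _ => ?_
    simp only [hσ i, Fin.ext_iff]

/-! ### Bounds of the exact order for Catalan numbers, squared to avoid roots -/

lemma Nat.centralBinom_sq_mul_le (n : ℕ) : n.centralBinom ^ 2 * (2 * n + 1) ≤ 16 ^ n := by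
  induction n with
  | zero => simp
  | succ n ih =>
    have h := n.succ_mul_centralBinom_succ
    refine Nat.le_of_mul_le_mul_left (c := (n + 1) ^ 2) ?_ (by positivity)
    calc (n + 1) ^ 2 * ((n + 1).centralBinom ^ 2 * (2 * (n + 1) + 1))
        = ((n + 1) * (n + 1).centralBinom) ^ 2 * (2 * n + 3) := by ring
      _ = 4 * (2 * n + 1) * (2 * n + 3) * (n.centralBinom ^ 2 * (2 * n + 1)) := by rw [h]; ring
      _ ≤ 4 * (2 * n + 1) * (2 * n + 3) * 16 ^ n := Nat.mul_le_mul_left _ ih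
      _ ≤ 16 * (n + 1) ^ 2 * 16 ^ n := Nat.mul_le_mul_right _ (by nlinarith)
      _ = (n + 1) ^ 2 * 16 ^ (n + 1) := by ring

lemma Nat.le_centralBinom_sq_mul {n : ℕ} (hn : 1 ≤ n) :
    16 ^ n ≤ n.centralBinom ^ 2 * (4 * n) := by
  induction n, hn using Nat.le_induction with
  | base => simp [Nat.centralBinom, Nat.choose]
  | succ n hn ih =>
    have h := n.succ_mul_centralBinom_succ
    refine Nat.le_of_mul_le_mul_left (c := n * (n + 1)) ?_ (by positivity)
    calc n * (n + 1) * 16 ^ (n + 1) = 16 * n * (n + 1) * 16 ^ n := by ring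
      _ ≤ 16 * n * (n + 1) * (n.centralBinom ^ 2 * (4 * n)) := Nat.mul_le_mul_left _ ih
      _ = 16 * (n * (n + 1)) * (4 * n * n.centralBinom ^ 2) := by ring
      _ ≤ 4 * (2 * n + 1) ^ 2 * (4 * n * n.centralBinom ^ 2) :=
        Nat.mul_le_mul_right _ (by nlinarith)
      _ = (2 * (2 * n + 1) * n.centralBinom) ^ 2 * (4 * n) := by ring
      _ = n * (n + 1) * ((n + 1).centralBinom ^ 2 * (4 * (n + 1))) := by rw [← h]; ring

lemma catalan_pos (n : ℕ) : 0 < catalan n := by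
  have h := succ_mul_catalan_eq_centralBinom n
  have := n.centralBinom_pos
  exact Nat.pos_of_mul_pos_left (h ▸ this)

lemma catalan_le_four_pow (n : ℕ) : catalan n ≤ 4 ^ n := by
  have h := succ_mul_catalan_eq_centralBinom n
  have := n.centralBinom_le_four_pow
  nlinarith

lemma catalan_sq_mul_le (n : ℕ) : catalan n ^ 2 * (n + 1) ^ 3 ≤ 16 ^ n := by
  refine le_trans ?_ n.centralBinom_sq_mul_le
  rw [← succ_mul_catalan_eq_centralBinom]
  calc catalan n ^ 2 * (n + 1) ^ 3 = ((n + 1) * catalan n) ^ 2 * (n + 1) := by ring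
    _ ≤ _ := Nat.mul_le_mul_left _ (by omega)

lemma le_catalan_sq_mul {n : ℕ} (hn : 1 ≤ n) : 16 ^ n ≤ catalan n ^ 2 * (16 * n ^ 3) := by
  refine (Nat.le_centralBinom_sq_mul hn).trans ?_
  rw [← succ_mul_catalan_eq_centralBinom]
  calc ((n + 1) * catalan n) ^ 2 * (4 * n) = catalan n ^ 2 * (4 * n) * (n + 1) ^ 2 := by ring
    _ ≤ catalan n ^ 2 * (4 * n) * (2 * n) ^ 2 := by gcongr; omega
    _ = _ := by ring

/-! ### The expectation and the window estimates -/

lemma sum_catalan_mul_catalan (m : ℕ) :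
    ∑ p ∈ Finset.range (m + 1), catalan p * catalan (m - p) = catalan (m + 1) := by
  rw [catalan_succ', Finset.Nat.sum_antidiagonal_eq_sum_range_succ_mk]

theorem uniformExpectation_numFixedPoints (m : ℕ) :
    uniformExpectation (avoidingPerms (m + 1) pattern132)
      (fun σ => (numFixedPoints σ : ℝ)) = 1 := by
  have h := sum_card_fixedPoints m fun _ => True
  simp only [and_true, if_true, ← Finset.mul_sum, sum_catalanPowCoeff_sq,
    sum_catalan_mul_catalan] at h
  have hpos : (catalan (m + 1) : ℝ) ≠ 0 := Nat.cast_ne_zero.2 (catalan_pos _).ne'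
  rw [uniformExpectation, card_avoidingPerms_pattern132, div_eq_one_iff_eq hpos, ← h]
  simp [numFixedPoints]

open Classical in
-- First moment bound.
lemma uniformProb_hasFixedPointInWindow_le (ε a : ℝ) (m : ℕ) :
    uniformProb (avoidingPerms (m + 1) pattern132) (fun σ => HasFixedPointInWindow ε a σ) ≤
      (∑ p ∈ Finset.range (m + 1), ∑ x ∈ ballotIndex (m - p),
        if ((p + x.1 : ℕ) : ℝ) + 1 ∈
            Set.Icc ((a - ε) * (m + 1 : ℕ)) ((a + ε) * (m + 1 : ℕ)) then
          (catalan p : ℝ) * (catalanPowCoeff x.1 (x.2 + 1) : ℝ) ^ 2 else 0) /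
        catalan (m + 1) := by
  have h := sum_card_fixedPoints m fun i =>
    (i : ℝ) + 1 ∈ Set.Icc ((a - ε) * (m + 1 : ℕ)) ((a + ε) * (m + 1 : ℕ))
  have hc : ((avoidingPerms (m + 1) pattern132).filter
      fun σ => HasFixedPointInWindow ε a σ).card ≤ ∑ σ ∈ avoidingPerms (m + 1) pattern132,
        (Finset.univ.filter fun i : Fin (m + 1) => σ i = i ∧ ((i : ℕ) : ℝ) + 1 ∈
          Set.Icc ((a - ε) * (m + 1 : ℕ)) ((a + ε) * (m + 1 : ℕ))).card := by
    rw [Finset.card_filter]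
    refine Finset.sum_le_sum fun σ _ => ?_
    split_ifs with hσ
    · obtain ⟨i, hi, hσi⟩ := hσ
      exact Finset.card_pos.2 ⟨i, Finset.mem_filter.2 ⟨Finset.mem_univ _, hσi, hi⟩⟩
    · exact Nat.zero_le _
  rw [h] at hc
  rw [uniformProb, card_avoidingPerms_pattern132]
  gcongr
  refine (Nat.cast_le.2 hc).trans_eq ?_
  push_cast
  rfl

lemma uniformProb_nonneg {α : Type*} (S : Finset α) (p : α → Prop) : 0 ≤ uniformProb S p := by
  unfold uniformProb
  positivity

/-- A Chernoff bound: `y = exp κ` in `catalanPowCoeff_mul_pow_le`, with `cosh κ ≤ exp (κ^2 / 2)`. -/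
lemma catalanPowCoeff_sq_le_exp {w h N : ℕ} {κ : ℝ} (hκ : 0 ≤ κ) (hN : 2 * w + h ≤ N)
    (hh : κ * N ≤ h) :
    (catalanPowCoeff w (h + 1) : ℝ) ^ 2 ≤ 4 ^ (2 * w + h) * Real.exp (-κ ^ 2) ^ N := by
  have h1 := catalanPowCoeff_mul_pow_le w h (Real.exp_pos κ)
  have h2 : Real.exp κ + (Real.exp κ)⁻¹ ≤ 2 * Real.exp (κ ^ 2 / 2) := by
    have := Real.cosh_le_exp_half_sq κ
    rw [Real.cosh_eq, Real.exp_neg] at this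
    linarith
  have h3 : (catalanPowCoeff w (h + 1) : ℝ) * Real.exp κ ^ h ≤
      (2 * Real.exp (κ ^ 2 / 2)) ^ (2 * w + h) :=
    h1.trans (pow_le_pow_left₀ (by positivity) h2 _)
  have h4 : (catalanPowCoeff w (h + 1) : ℝ) ≤
      2 ^ (2 * w + h) * Real.exp (κ ^ 2 / 2 * (2 * w + h : ℕ) - κ * h) := by
    rw [← le_div_iff₀ (by positivity)] at h3
    refine h3.trans_eq ?_
    rw [mul_pow, ← Real.exp_nat_mul, ← Real.exp_nat_mul, Real.exp_sub, mul_div_assoc,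
      mul_comm (κ ^ 2 / 2), mul_comm κ]
  calc (catalanPowCoeff w (h + 1) : ℝ) ^ 2
      ≤ (2 ^ (2 * w + h) * Real.exp (κ ^ 2 / 2 * (2 * w + h : ℕ) - κ * h)) ^ 2 :=
        pow_le_pow_left₀ (by positivity) h4 2
    _ = 4 ^ (2 * w + h) * Real.exp (κ ^ 2 * (2 * w + h : ℕ) - 2 * (κ * h)) := by
        rw [mul_pow, ← pow_mul, mul_comm _ 2, pow_mul, ← Real.exp_nat_mul]
        norm_num
        ring_nf
    _ ≤ 4 ^ (2 * w + h) * Real.exp (N * -κ ^ 2) := by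
        gcongr
        have h5 : ((2 * w + h : ℕ) : ℝ) ≤ N := Nat.cast_le.2 hN
        nlinarith [mul_le_mul_of_nonneg_left h5 (sq_nonneg κ), mul_le_mul_of_nonneg_left hh hκ]
    _ = _ := by rw [Real.exp_nat_mul]

lemma card_ballotIndex_le (m : ℕ) : (ballotIndex m).card ≤ (m + 1) ^ 2 :=
  (Finset.card_filter_le _ _).trans_eq (by simp [sq])

lemma uniformProb_le_of_add_lt_half {ε a : ℝ} (h : a + ε < 1 / 2) (m : ℕ) :
    uniformProb (avoidingPerms (m + 1) pattern132) (fun σ => HasFixedPointInWindow ε a σ) ≤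
      16 * (((m + 1 : ℕ) : ℝ) ^ 5 * Real.exp (-(1 - 2 * (a + ε)) ^ 2) ^ (m + 1)) := by
  classical
  set κ := 1 - 2 * (a + ε) with hκ
  have hκ0 : 0 < κ := by linarith
  refine (uniformProb_hasFixedPointInWindow_le ε a m).trans ?_
  rw [div_le_iff₀ (Nat.cast_pos.2 (catalan_pos _))]
  have hterm : ∀ p ∈ Finset.range (m + 1), ∀ x ∈ ballotIndex (m - p),
      (if ((p + x.1 : ℕ) : ℝ) + 1 ∈
          Set.Icc ((a - ε) * (m + 1 : ℕ)) ((a + ε) * (m + 1 : ℕ)) then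
        (catalan p : ℝ) * (catalanPowCoeff x.1 (x.2 + 1) : ℝ) ^ 2 else 0) ≤
      4 ^ m * Real.exp (-κ ^ 2) ^ (m + 1) := by
    intro p hp x hx
    rw [Finset.mem_range] at hp
    rw [mem_ballotIndex] at hx
    split_ifs with hw
    · have hsum : p + 2 * x.1 + x.2 = m := by omega
      have hsum' : (p : ℝ) + 2 * x.1 + x.2 = m := by exact_mod_cast hsum
      -- `h = m - p - 2w ≥ m - 2(p + w)`, and the window bounds `p + w + 1`.
      have hh : κ * (m + 1 : ℕ) ≤ x.2 := by
        have := hw.2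
        push_cast at this ⊢
        have hp0 : (0 : ℝ) ≤ p := Nat.cast_nonneg p
        nlinarith
      have h1 := catalanPowCoeff_sq_le_exp hκ0.le (by omega : 2 * x.1 + x.2 ≤ m + 1) hh
      have h2 : (catalan p : ℝ) ≤ 4 ^ p := by exact_mod_cast catalan_le_four_pow p
      calc _ ≤ (4 : ℝ) ^ p * (4 ^ (2 * x.1 + x.2) * Real.exp (-κ ^ 2) ^ (m + 1)) := by gcongr
        _ = _ := by rw [← mul_assoc, ← pow_add, ← add_assoc, hsum]
    · positivity
  have hsum : (∑ p ∈ Finset.range (m + 1), ∑ x ∈ ballotIndex (m - p),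
      if ((p + x.1 : ℕ) : ℝ) + 1 ∈
          Set.Icc ((a - ε) * (m + 1 : ℕ)) ((a + ε) * (m + 1 : ℕ)) then
        (catalan p : ℝ) * (catalanPowCoeff x.1 (x.2 + 1) : ℝ) ^ 2 else 0) ≤
      ((m + 1 : ℕ) : ℝ) ^ 3 * (4 ^ m * Real.exp (-κ ^ 2) ^ (m + 1)) := by
    calc _ ≤ ∑ p ∈ Finset.range (m + 1),
          ((m + 1 : ℕ) : ℝ) ^ 2 * (4 ^ m * Real.exp (-κ ^ 2) ^ (m + 1)) := by
          refine Finset.sum_le_sum fun p hp => (Finset.sum_le_card_nsmul _ _ _ (hterm p hp)).trans ?_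
          rw [nsmul_eq_mul]
          gcongr
          have := card_ballotIndex_le (m - p)
          have h2 : (m - p + 1) ^ 2 ≤ (m + 1) ^ 2 := Nat.pow_le_pow_left (by omega) 2
          exact_mod_cast this.trans h2
      _ = _ := by
          rw [Finset.sum_const, Finset.card_range, nsmul_eq_mul]
          ring
  refine hsum.trans ?_
  -- A crude bound suffices, since the exponential factor absorbs any power of `m + 1`.
  have hcat : (4 : ℝ) ^ m ≤ 4 * ((m + 1 : ℕ) : ℝ) ^ 2 * catalan (m + 1) := by
    have h1 := Nat.four_pow_le_two_mul_self_mul_centralBinom (m + 1) (by omega)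
    rw [← succ_mul_catalan_eq_centralBinom] at h1
    have h2 : 4 ^ m ≤ 4 * (m + 1) ^ 2 * catalan (m + 1) := by
      calc 4 ^ m ≤ 4 ^ (m + 1) := Nat.pow_le_pow_right (by norm_num) (by omega)
        _ ≤ _ := h1
        _ = 2 * (m + 1) * (m + 1 + 1) * catalan (m + 1) := by ring
        _ ≤ _ := Nat.mul_le_mul_right _ (by nlinarith)
    exact_mod_cast h2
  calc ((m + 1 : ℕ) : ℝ) ^ 3 * (4 ^ m * Real.exp (-κ ^ 2) ^ (m + 1))
      ≤ ((m + 1 : ℕ) : ℝ) ^ 3 *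
          (4 * ((m + 1 : ℕ) : ℝ) ^ 2 * catalan (m + 1) * Real.exp (-κ ^ 2) ^ (m + 1)) := by gcongr
    _ = 4 * ((((m + 1 : ℕ) : ℝ) ^ 5 * Real.exp (-κ ^ 2) ^ (m + 1)) * catalan (m + 1)) := by ring
    _ ≤ 16 * ((((m + 1 : ℕ) : ℝ) ^ 5 * Real.exp (-κ ^ 2) ^ (m + 1)) * catalan (m + 1)) := by
        gcongr
        norm_num
    _ = _ := by ring

lemma catalan_mul_catalan_sq_le {p m : ℕ} (hp : p ≤ m) {κ l : ℝ} (hκ : 0 < κ) (hl : 0 < l)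
    (h1 : κ * (m + 1 : ℕ) ≤ p + 1) (h2 : l * (m + 1 : ℕ) ≤ (m - p : ℕ) + 1) :
    ((catalan p * catalan (m - p) : ℕ) : ℝ) ^ 2 * ((κ * l) ^ 3 * ((m + 1 : ℕ) : ℝ) ^ 6) ≤
      16 ^ m := by
  have h3 : (catalan p : ℝ) ^ 2 * (p + 1) ^ 3 ≤ 16 ^ p := by exact_mod_cast catalan_sq_mul_le p
  have h4 : (catalan (m - p) : ℝ) ^ 2 * ((m - p : ℕ) + 1) ^ 3 ≤ 16 ^ (m - p) := by
    exact_mod_cast catalan_sq_mul_le (m - p)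
  calc ((catalan p * catalan (m - p) : ℕ) : ℝ) ^ 2 * ((κ * l) ^ 3 * ((m + 1 : ℕ) : ℝ) ^ 6)
      = ((catalan p : ℝ) ^ 2 * (κ * (m + 1 : ℕ)) ^ 3) *
          ((catalan (m - p) : ℝ) ^ 2 * (l * (m + 1 : ℕ)) ^ 3) := by
        push_cast
        ring
    _ ≤ ((catalan p : ℝ) ^ 2 * (p + 1) ^ 3) *
          ((catalan (m - p) : ℝ) ^ 2 * ((m - p : ℕ) + 1) ^ 3) := by gcongr
    _ ≤ 16 ^ p * 16 ^ (m - p) := by gcongr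
    _ = 16 ^ m := by rw [← pow_add, Nat.add_sub_cancel' hp]

/-- Each of the `m + 1` values of `p` contributes at most `B`, of order `4^m n^(-3)`; dividing by
`catalan (m + 1)` leaves `O(n^(-1/2))`. -/
lemma uniformProb_le_of_half_lt {ε a : ℝ} (h1 : 1 / 2 < a - ε) (h2 : a + ε < 1) (m : ℕ) :
    uniformProb (avoidingPerms (m + 1) pattern132) (fun σ => HasFixedPointInWindow ε a σ) ≤
      √((((2 * (a - ε) - 1) * (1 - (a + ε))) ^ 3)⁻¹ / (m + 1 : ℕ)) := by
  classical
  set κ := 2 * (a - ε) - 1 with hκ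
  set l := 1 - (a + ε) with hl
  have hκ0 : 0 < κ := by linarith
  have hl0 : 0 < l := by linarith
  have hC : (0 : ℝ) < catalan (m + 1) := Nat.cast_pos.2 (catalan_pos _)
  set n : ℝ := ((m + 1 : ℕ) : ℝ) with hn
  have hn0 : 0 < n := by positivity
  set B := √(16 ^ m / ((κ * l) ^ 3 * n ^ 6)) with hB
  refine (uniformProb_hasFixedPointInWindow_le ε a m).trans ?_
  have hterm : ∀ p ∈ Finset.range (m + 1), (∑ x ∈ ballotIndex (m - p),
      if ((p + x.1 : ℕ) : ℝ) + 1 ∈ Set.Icc ((a - ε) * n) ((a + ε) * n) then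
        (catalan p : ℝ) * (catalanPowCoeff x.1 (x.2 + 1) : ℝ) ^ 2 else 0) ≤ B := by
    intro p hp
    rw [Finset.mem_range, Nat.lt_succ_iff] at hp
    -- A fixed point at `i = p + w` has `2i - m ≤ p ≤ i`, so for other `p` no index meets the
    -- window.
    by_cases hpw : κ * n ≤ p + 1 ∧ l * n ≤ (m - p : ℕ) + 1
    · calc _ ≤ ∑ x ∈ ballotIndex (m - p),
            (catalan p : ℝ) * (catalanPowCoeff x.1 (x.2 + 1) : ℝ) ^ 2 := by
            refine Finset.sum_le_sum fun x _ => ?_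
            split_ifs
            · exact le_rfl
            · positivity
        _ = (catalan p * catalan (m - p) : ℕ) := by
            rw [← Finset.mul_sum, ← sum_catalanPowCoeff_sq (m - p)]
            push_cast
            rfl
        _ ≤ B := by
            refine Real.le_sqrt_of_sq_le ?_
            rw [le_div_iff₀ (by positivity)]
            exact catalan_mul_catalan_sq_le hp hκ0 hl0 hpw.1 hpw.2
    · refine (Finset.sum_eq_zero fun x hx => if_neg fun hw => hpw ?_).trans_le (Real.sqrt_nonneg _)
      rw [mem_ballotIndex] at hx
      have hs : p + 2 * x.1 + x.2 = m := by omega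
      have hs' : (p : ℝ) + 2 * x.1 + x.2 = m := by exact_mod_cast hs
      have hx1 : (0 : ℝ) ≤ x.1 := Nat.cast_nonneg _
      have hx2 : (0 : ℝ) ≤ x.2 := Nat.cast_nonneg _
      have hw1 := hw.1
      have hw2 := hw.2
      have hnm : n = m + 1 := by simp [hn]
      rw [Nat.cast_sub hp]
      push_cast at hw1 hw2
      constructor <;> nlinarith
  have hsum := Finset.sum_le_card_nsmul _ _ _ hterm
  rw [Finset.card_range, nsmul_eq_mul] at hsum
  refine (div_le_div_of_nonneg_right hsum hC.le).trans (Real.le_sqrt_of_sq_le ?_)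
  have hcat : (16 : ℝ) ^ (m + 1) ≤ (catalan (m + 1) : ℝ) ^ 2 * (16 * n ^ 3) := by
    rw [hn]
    exact_mod_cast le_catalan_sq_mul (Nat.le_add_left 1 m)
  rw [div_pow, mul_pow, hB, Real.sq_sqrt (by positivity), div_le_iff₀ (by positivity)]
  have hcat' : (16 : ℝ) ^ m ≤ (catalan (m + 1) : ℝ) ^ 2 * n ^ 3 := by
    rw [pow_succ] at hcat
    linarith
  calc n ^ 2 * (16 ^ m / ((κ * l) ^ 3 * n ^ 6))
      ≤ n ^ 2 * ((catalan (m + 1) : ℝ) ^ 2 * n ^ 3 / ((κ * l) ^ 3 * n ^ 6)) := by gcongr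
    _ = _ := by field_simp

theorem mainTheorem9 :
    (∀ n : ℕ, 1 ≤ n →
      uniformExpectation (avoidingPerms n pattern132) (fun σ => (numFixedPoints σ : ℝ)) = 1) ∧
    (∀ ε : ℝ, 0 < ε → ∀ a : ℝ, a ∈ Set.Ioo 0 (1 / 2 - ε) ∪ Set.Ioo (1 / 2 + ε) (1 - ε) →
      Tendsto (fun n : ℕ =>
        uniformProb (avoidingPerms n pattern132) (fun σ => HasFixedPointInWindow ε a σ))
        atTop (𝓝 0)) := by
  refine ⟨fun n hn => ?_, fun ε _ a ha => ?_⟩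
  · obtain ⟨m, rfl⟩ := Nat.exists_eq_add_of_le' hn
    exact uniformExpectation_numFixedPoints m
  · rw [← tendsto_add_atTop_iff_nat 1]
    rcases ha with ⟨-, ha⟩ | ⟨ha1, ha2⟩
    · refine squeeze_zero (fun _ => uniformProb_nonneg _ _)
        (uniformProb_le_of_add_lt_half (by linarith)) ?_
      have h0 : 0 < 1 - 2 * (a + ε) := by linarith
      have hr : |Real.exp (-(1 - 2 * (a + ε)) ^ 2)| < 1 := by
        rw [abs_of_pos (Real.exp_pos _), Real.exp_lt_one_iff]
        exact neg_neg_of_pos (by positivity)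
      have h := (tendsto_pow_const_mul_const_pow_of_abs_lt_one 5 hr).const_mul 16
      rw [mul_zero] at h
      exact (tendsto_add_atTop_iff_nat 1).2 h
    · refine squeeze_zero (fun _ => uniformProb_nonneg _ _)
        (uniformProb_le_of_half_lt (by linarith) (by linarith)) ?_
      have h := (tendsto_const_div_atTop_nhds_zero_nat
        (((2 * (a - ε) - 1) * (1 - (a + ε))) ^ 3)⁻¹).sqrt
      rw [Real.sqrt_zero] at h
      exact (tendsto_add_atTop_iff_nat 1).2 h
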